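/- Let $B=(B(t))_{0\le t\le 1}$ be a standard Brownian motion on a probability space, that is, a centred Gaussian process with $\mathbb{E}[B(s)B(t)]=\min(s,t)$ and almost surely continuous paths. Let $\eta_0(t)=t$ and, for $n\ge 1$ and $1\le i\le 2^{n-1}$, let $\eta_{n,i}$ be the Faber–Schauder function on $[0,1]$ given by $$\eta_{n,i}(t)=\begin{cases}2^{(n-1)/2}\left(t-\frac{2i-2}{2^n}\right), & t\in\left[\frac{2i-2}{2^n},\frac{2i-1}{2^n}\right],\\[2pt] 2^{(n-1)/2}\left(\frac{2i}{2^n}-t\right), & t\in\left[\frac{2i-1}{2^n},\frac{2i}{2^n}\right],\\[2pt] 0,&\text{otherwise.}\end{cases}$$ Let $$B(t)=X_0\,\eta_0(t)+\sum_{n=1}^{\infty}\sum_{i=1}^{2^{n-1}}X_{n,i}\,\eta_{n,i}(t),\qquad 0\le t\le 1,$$ be the Lévy–Ciesielski expansion of $B$, valid almost surely for all $t\in[0,1]$ (its coefficients $X_0$, $X_{n,i}$ are independent standard normal random variables), and for $N\ge 1$ let $$B_N(t)=X_0\,\eta_0(t)+\sum_{n=1}^{N}\sum_{i=1}^{2^{n-1}}X_{n,i}\,\eta_{n,i}(t)$$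 be its truncation at level $N$. Let $r,\sigma,S(0)\in\mathbb{R}$ and, for $0\le t\le 1$, put $$S(t)=S(0)\exp\left(\left(r-\tfrac{\sigma^2}{2}\right)t+\sigma B(t)\right),\qquad S_N(t)=S(0)\exp\left(\left(r-\tfrac{\sigma^2}{2}\right)t+\sigma B_N(t)\right).$$ Write $\|u\|_\infty=\sup_{t\in[0,1]}|u(t)|$ and $d=2^N$. Then there is a constant $C>0$ that depends only on $r$ and $\sigma$ such that, for every $N\ge 1$, the random variable $\|S-S_N\|_\infty$ is integrable and $$\mathbb{E}\left[\|S-S_N\|_\infty\right]\le C\,|S(0)|\,\frac{\sqrt N}{2^{N/2}}\qquad\text{and}\qquad \mathbb{E}\left[\|S-S_N\|_\infty\right]\le C\,|S(0)|\,\sqrt{\frac{\ln d}{d}}.$$ -/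

import Mathlib

open MeasureTheory ProbabilityTheory Filter Topology

noncomputable section

namespace GBM

/-- Standard Brownian motion on `[0,1]`: a centred Gaussian process with
`E[B(s) B(t)] = min(s,t)` and almost surely continuous paths. -/
structure IsStandardBrownianMotion {Ω : Type*} [MeasurableSpace Ω] (B : unitInterval → Ω → ℝ)
    (P : Measure Ω) : Prop where
  gaussian : IsGaussianProcess B P
  mean_zero : ∀ t, ∫ ω, B t ω ∂P = 0
  covariance : ∀ s t, ∫ ω, B s ω * B t ω ∂P = min (s : ℝ) (t : ℝ)
  continuous_paths : ∀ᵐ ω ∂P, Continuous fun t => B t ω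

/-- The Faber-Schauder function `η_{n,i}`, used for `n ≥ 1` and `1 ≤ i ≤ 2 ^ (n - 1)`. -/
def faberSchauder (n i : ℕ) (t : ℝ) : ℝ :=
  if (2 * (i : ℝ) - 2) / 2 ^ n ≤ t ∧ t ≤ (2 * (i : ℝ) - 1) / 2 ^ n then
    (2 : ℝ) ^ (((n : ℝ) - 1) / 2) * (t - (2 * (i : ℝ) - 2) / 2 ^ n)
  else if (2 * (i : ℝ) - 1) / 2 ^ n ≤ t ∧ t ≤ 2 * (i : ℝ) / 2 ^ n then
    (2 : ℝ) ^ (((n : ℝ) - 1) / 2) * (2 * (i : ℝ) / 2 ^ n - t)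
  else 0

/-- The Faber-Schauder series with coefficients `x₀` and `x n i`, truncated at level `N`:
`x₀ η₀(t) + ∑_{n=1}^N ∑_{i=1}^{2^(n-1)} x_{n,i} η_{n,i}(t)`, where `η₀(t) = t`. -/
def truncatedSeries (x₀ : ℝ) (x : ℕ → ℕ → ℝ) (N : ℕ) (t : unitInterval) : ℝ :=
  x₀ * (t : ℝ) +
    ∑ n ∈ Finset.Icc 1 N, ∑ i ∈ Finset.Icc 1 (2 ^ (n - 1)), x n i * faberSchauder n i (t : ℝ)

/-- The random coefficients `X₀`, `X n i` are those of the Lévy-Ciesielski (Faber-Schauder)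
expansion of the process `B`: almost surely, for all `t ∈ [0,1]`,
`B(t) = X₀ η₀(t) + ∑_{n=1}^∞ ∑_{i=1}^{2^(n-1)} X_{n,i} η_{n,i}(t)`.
Nothing is assumed on the law of the coefficients; if `B` is a standard Brownian motion they are
automatically independent standard normal random variables. -/
def IsLevyCiesielskiExpansion {Ω : Type*} [MeasurableSpace Ω] (X₀ : Ω → ℝ) (X : ℕ → ℕ → Ω → ℝ)
    (B : unitInterval → Ω → ℝ) (P : Measure Ω) : Prop :=
  ∀ᵐ ω ∂P, ∀ t : unitInterval,
    Tendsto (fun N => truncatedSeries (X₀ ω) (fun n i => X n i ω) N t) atTop (𝓝 (B t ω))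

/-- `S(t) = S(0) exp((r - σ²/2) t + σ b(t))` for the driving path `b`. -/
def geometric (S₀ r σ : ℝ) (b : unitInterval → ℝ) (t : unitInterval) : ℝ :=
  S₀ * Real.exp ((r - σ ^ 2 / 2) * (t : ℝ) + σ * b t)

/-- The uniform norm on `[0,1]` (of a bounded function). -/
def uniformNorm (u : unitInterval → ℝ) : ℝ := ⨆ t, |u t|

/-- The uniform error `‖S - S_N‖_∞` as a random variable. -/
def uniformError {Ω : Type*} (S₀ r σ : ℝ) (B : unitInterval → Ω → ℝ) (X₀ : Ω → ℝ)
    (X : ℕ → ℕ → Ω → ℝ) (N : ℕ) (ω : Ω) : ℝ :=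
  uniformNorm fun t =>
    geometric S₀ r σ (fun s => B s ω) t -
      geometric S₀ r σ (truncatedSeries (X₀ ω) (fun n i => X n i ω) N) t

end GBM

end

/-! Everything reduces to one random variable with finite mean that controls all coefficients at
once. Evaluating the series at dyadic points shows that each coefficient is a normalized second
difference of `B` (`coefficient_eq`), hence standard normal; only these marginal laws enter, not
independence.

Let W be the sum of exp(X₀²/4) and of all 4^(-n-1) exp(X_{n+1,i}²/4). Its mean is finite
(`lintegral_expSqSum_le`), and since each term is at most W, all coefficients satisfy |X_{n+1,i}| ≤
M √(n+1) with M = 2 √(log 4 + log(1+W)). Tents of one level have disjoint supports, so that level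
contributes at most M √(n+1) 2^(-n/2), and the tail after level N is O(M √(N+1) 2^(-N/2)) uniformly
in t.

The exponential costs a factor exp(aM). As M²/4 = log(4(1+W)), completing the square bounds M
exp(aM) by a constant times 1+W (`exp_mul_coefficientBound_le`), so the pathwise bound
`abs_geometric_sub_le_expSqSum` can be integrated. -/

noncomputable section
namespace GBM

/-! ### Tent functions and rescaling -/

/-- The tent function of height one and half-width one centred at `2 i - 1`. -/
def tent (i : ℕ) (u : ℝ) : ℝ := max 0 (1 - |u - (2 * (i : ℝ) - 1)|)

lemma two_rpow_div_two_pow (n : ℕ) :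
    (2 : ℝ) ^ (((n : ℝ) - 1) / 2) / 2 ^ n = (√2)⁻¹ ^ (n + 1) := by
  have hs : (√2 : ℝ) ^ 2 = 2 := Real.sq_sqrt (by norm_num)
  have hs0 : (0 : ℝ) < √2 := by positivity
  have h1 : (2 : ℝ) ^ (((n : ℝ) - 1) / 2) = √2 ^ n / √2 := by
    rw [show ((n : ℝ) - 1) / 2 = (1 / 2) * ((n : ℝ) - 1) by ring, Real.rpow_mul (by norm_num),
      ← Real.sqrt_eq_rpow, Real.rpow_sub_one hs0.ne', Real.rpow_natCast]
  have h2 : (2 : ℝ) ^ n = √2 ^ n * √2 ^ n := by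
    rw [← mul_pow, ← sq, hs]
  rw [h1, h2, inv_pow, pow_succ]
  field_simp

/-- In the variable 2^n t all breakpoints are integers, so later vanishing and affinity claims
become integer arithmetic. -/
lemma faberSchauder_eq (n i : ℕ) (t : ℝ) :
    faberSchauder n i t = (√2)⁻¹ ^ (n + 1) * tent i (2 ^ n * t) := by
  rw [← two_rpow_div_two_pow]
  unfold faberSchauder tent
  have h2 : (0 : ℝ) < 2 ^ n := by positivity
  generalize (2 : ℝ) ^ (((n : ℝ) - 1) / 2) = a
  simp only [div_le_iff₀ h2, le_div_iff₀ h2]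
  have e : t * 2 ^ n = 2 ^ n * t := mul_comm _ _
  rw [e]
  have hu : t = (2 ^ n * t) / 2 ^ n := by field_simp
  generalize 2 ^ n * t = u at *
  subst hu
  split_ifs with h h'
  · rw [abs_of_nonpos (by linarith), max_eq_right (by linarith)]; field_simp; ring
  · rw [abs_of_nonneg (by linarith), max_eq_right (by linarith)]; field_simp; ring
  · rw [max_eq_left, mul_zero]
    by_contra! hc
    have := abs_lt.1 (show |u - (2 * (i : ℝ) - 1)| < 1 by linarith)
    rcases le_total u (2 * (i : ℝ) - 1) with hh | hh
    · exact h ⟨by linarith, hh⟩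
    · exact h' ⟨hh, by linarith⟩

lemma tent_nonneg (i : ℕ) (u : ℝ) : 0 ≤ tent i u := le_max_left _ _

lemma tent_le_one (i : ℕ) (u : ℝ) : tent i u ≤ 1 :=
  max_le zero_le_one (by linarith [abs_nonneg (u - (2 * (i : ℝ) - 1))])

lemma tent_eq_zero {i : ℕ} {u : ℝ} (h : 1 ≤ |u - (2 * (i : ℝ) - 1)|) : tent i u = 0 :=
  max_eq_left (by linarith)

lemma continuous_tent (i : ℕ) : Continuous (tent i) := by unfold tent; fun_prop

lemma tent_even (i k : ℕ) : tent i (2 * (k : ℝ)) = 0 := by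
  apply tent_eq_zero
  have : (1 : ℤ) ≤ |2 * (k : ℤ) - (2 * (i : ℤ) - 1)| := by
    apply Int.one_le_abs; omega
  exact_mod_cast this

lemma tent_odd (i j : ℕ) : tent i (2 * (j : ℝ) - 1) = if i = j then 1 else 0 := by
  split_ifs with h
  · subst h; simp [tent]
  · apply tent_eq_zero
    have : (1 : ℤ) ≤ |2 * (j : ℤ) - 1 - (2 * (i : ℤ) - 1)| := by
      apply Int.one_le_abs; omega
    exact_mod_cast this

/-- The tent functions have disjoint supports. -/
lemma sum_tent_le_one (s : Finset ℕ) (u : ℝ) : ∑ i ∈ s, tent i u ≤ 1 := by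
  by_cases h : ∃ j ∈ s, tent j u ≠ 0
  · obtain ⟨j, hj, hne⟩ := h
    rw [Finset.sum_eq_single_of_mem j hj]
    · exact tent_le_one j u
    · intro i _ hij
      have h1 : |u - (2 * (j : ℝ) - 1)| < 1 := by
        by_contra! hc
        exact hne (tent_eq_zero hc)
      apply tent_eq_zero
      -- Distinct centres are odd integers, hence at distance at least 2.
      have h2 : (2 : ℤ) ≤ |2 * (i : ℤ) - 2 * (j : ℤ)| := by
        rw [← mul_sub, abs_mul]
        have : (1 : ℤ) ≤ |(i : ℤ) - j| := by apply Int.one_le_abs; omega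
        norm_num; linarith
      have h3 : (2 : ℝ) ≤ |2 * (i : ℝ) - 2 * (j : ℝ)| := by exact_mod_cast h2
      have h4 : |2 * (i : ℝ) - 2 * (j : ℝ)|
          ≤ |u - (2 * (j : ℝ) - 1)| + |u - (2 * (i : ℝ) - 1)| := by
        rw [show 2 * (i : ℝ) - 2 * j = (u - (2 * (j : ℝ) - 1)) - (u - (2 * (i : ℝ) - 1)) by ring]
        exact abs_sub _ _
      linarith
  · push Not at h
    rw [Finset.sum_eq_zero h]
    exact zero_le_one

/-- Tent functions are affine between consecutive integers. -/
lemma tent_midpoint (i p : ℕ) {u v : ℝ} (hu : (p : ℝ) ≤ u) (hu' : u ≤ p + 1) (hv : (p : ℝ) ≤ v)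
    (hv' : v ≤ p + 1) : tent i ((u + v) / 2) = (tent i u + tent i v) / 2 := by
  unfold tent
  rcases lt_trichotomy (2 * (i : ℤ) - 1) p with h | h | h
  · have h : 2 * (i : ℝ) - 1 + 1 ≤ p := by exact_mod_cast h
    rw [abs_of_nonneg, abs_of_nonneg, abs_of_nonneg, max_eq_left, max_eq_left, max_eq_left] <;>
      linarith
  · have h : 2 * (i : ℝ) - 1 = p := by exact_mod_cast h
    rw [abs_of_nonneg, abs_of_nonneg, abs_of_nonneg, max_eq_right, max_eq_right, max_eq_right] <;>
      linarith
  · have h : (p : ℝ) + 1 ≤ 2 * (i : ℝ) - 1 := by exact_mod_cast h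
    rw [abs_of_nonpos, abs_of_nonpos, abs_of_nonpos] <;> try linarith
    rcases eq_or_lt_of_le (show (p : ℤ) + 1 ≤ 2 * (i : ℤ) - 1 by exact_mod_cast h) with h' | h'
    · have h' : (p : ℝ) + 1 = 2 * (i : ℝ) - 1 := by exact_mod_cast h'
      rw [max_eq_right, max_eq_right, max_eq_right] <;> linarith
    · have h' : (p : ℝ) + 1 + 1 ≤ 2 * (i : ℝ) - 1 := by exact_mod_cast h'
      rw [max_eq_left, max_eq_left, max_eq_left] <;> linarith

/-! ### Values at dyadic points -/

/-- The dyadic point `k / 2 ^ n`, truncated at `1`. -/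
def dyadic (n k : ℕ) : unitInterval :=
  ⟨min 1 ((k : ℝ) / 2 ^ n), le_min zero_le_one (by positivity), min_le_left _ _⟩

lemma coe_dyadic {n k : ℕ} (h : k ≤ 2 ^ n) : (dyadic n k : ℝ) = k / 2 ^ n := by
  have : (k : ℝ) ≤ 2 ^ n := by exact_mod_cast h
  exact min_eq_right (div_le_one_of_le₀ this (by positivity))

lemma faberSchauder_div_two_pow {m n : ℕ} (h : n < m) (i k : ℕ) :
    faberSchauder m i (k / 2 ^ n) = 0 := by
  obtain ⟨d, rfl⟩ := Nat.exists_eq_add_of_lt h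
  rw [faberSchauder_eq, show (2 : ℝ) ^ (n + d + 1) * (k / 2 ^ n) = 2 * ((2 ^ d * k : ℕ) : ℝ) by
    push_cast; rw [pow_succ, pow_add]; field_simp, tent_even, mul_zero]

lemma faberSchauder_midpoint {m n : ℕ} (h : m ≤ n) (i j : ℕ) :
    faberSchauder m i ((2 * j + 1) / 2 ^ (n + 1)) =
      (faberSchauder m i (j / 2 ^ n) + faberSchauder m i ((j + 1 : ℕ) / 2 ^ n)) / 2 := by
  obtain ⟨d, rfl⟩ := Nat.exists_eq_add_of_le h
  simp only [faberSchauder_eq]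
  -- Natural-number division: the floor of j / 2^d is the left end of the unit interval containing
  -- both rescaled endpoints.
  rw [← mul_add, mul_div_assoc, ← tent_midpoint i (j / 2 ^ d)]
  · congr 2; push_cast; rw [pow_succ, pow_add]; field_simp; ring
  all_goals
    rw [pow_add]
    field_simp
    norm_cast
  · exact Nat.div_mul_le_self j _
  · rw [mul_comm, Nat.add_mul, one_mul]
    exact (Nat.lt_div_mul_add (by positivity)).le
  · exact (Nat.div_mul_le_self j _).trans (Nat.le_succ j)
  · rw [mul_comm, Nat.add_mul, one_mul]
    exact Nat.lt_div_mul_add (by positivity)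

/-! ### Deterministic estimates for the series -/

section Deterministic

variable (x₀ : ℝ) (x : ℕ → ℕ → ℝ)

lemma truncatedSeries_succ (N : ℕ) (t : unitInterval) :
    truncatedSeries x₀ x (N + 1) t = truncatedSeries x₀ x N t +
      ∑ i ∈ Finset.Icc 1 (2 ^ N), x (N + 1) i * faberSchauder (N + 1) i t := by
  unfold truncatedSeries
  rw [Finset.sum_Icc_succ_top (by omega), add_assoc]
  rfl

lemma truncatedSeries_zero (t : unitInterval) : truncatedSeries x₀ x 0 t = x₀ * t := by
  simp [truncatedSeries]

lemma continuous_truncatedSeries (N : ℕ) : Continuous (truncatedSeries x₀ x N) := by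
  unfold truncatedSeries
  simp only [faberSchauder_eq]
  have := continuous_tent
  fun_prop

lemma truncatedSeries_dyadic {n N k : ℕ} (hk : k ≤ 2 ^ n) (h : n ≤ N) :
    truncatedSeries x₀ x N (dyadic n k) = truncatedSeries x₀ x n (dyadic n k) := by
  induction N, h using Nat.le_induction with
  | base => rfl
  | succ N h ih =>
    rw [truncatedSeries_succ, ih, coe_dyadic hk]
    simp [faberSchauder_div_two_pow (show n < N + 1 by omega)]

lemma truncatedSeries_one (N : ℕ) : truncatedSeries x₀ x N 1 = x₀ := by
  have h : dyadic 0 1 = 1 := by ext; rw [coe_dyadic (by norm_num)]; simp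
  rw [← h, truncatedSeries_dyadic x₀ x (by norm_num) (Nat.zero_le N), h, truncatedSeries_zero]
  simp

lemma truncatedSeries_midpoint {n j : ℕ} (hj : j < 2 ^ n) :
    truncatedSeries x₀ x n (dyadic (n + 1) (2 * j + 1)) =
      (truncatedSeries x₀ x n (dyadic n j) + truncatedSeries x₀ x n (dyadic n (j + 1))) / 2 := by
  unfold truncatedSeries
  rw [coe_dyadic hj.le, coe_dyadic hj, coe_dyadic (by rw [pow_succ]; omega),
    add_add_add_comm, ← Finset.sum_add_distrib, add_div, Finset.sum_div]
  congr 1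
  · push_cast; rw [pow_succ]; field_simp; ring
  · refine Finset.sum_congr rfl fun m hm => ?_
    rw [← Finset.sum_add_distrib, Finset.sum_div]
    refine Finset.sum_congr rfl fun i _ => ?_
    have := faberSchauder_midpoint (Finset.mem_Icc.1 hm).2 i j
    push_cast at this ⊢
    rw [this]
    ring

/-- The coefficients of the series are the scaled second differences of its sum. -/
lemma coefficient_eq {b : unitInterval → ℝ}
    (h : ∀ t, Tendsto (fun N => truncatedSeries x₀ x N t) atTop (𝓝 (b t))) {n j : ℕ}
    (hj : j < 2 ^ n) :
    x (n + 1) (j + 1) * (√2)⁻¹ ^ (n + 2) =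
      b (dyadic (n + 1) (2 * j + 1)) - (b (dyadic n j) + b (dyadic n (j + 1))) / 2 := by
  -- At a dyadic point of level m the partial sums are constant from level m on.
  have hb : ∀ {m k : ℕ}, k ≤ 2 ^ m → b (dyadic m k) = truncatedSeries x₀ x m (dyadic m k) := by
    intro m k hk
    refine tendsto_nhds_unique (h _) (tendsto_const_nhds.congr' ?_)
    filter_upwards [eventually_ge_atTop m] with N hN
    exact (truncatedSeries_dyadic x₀ x hk hN).symm
  have hk : 2 * j + 1 ≤ 2 ^ (n + 1) := by rw [pow_succ]; omega
  rw [hb hk, hb hj.le, hb hj, truncatedSeries_succ, truncatedSeries_midpoint x₀ x hj,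
    add_sub_cancel_left]
  -- The midpoint is the peak of tent j + 1 and a zero of the others of its level.
  rw [coe_dyadic hk, Finset.sum_eq_single_of_mem (j + 1) (by simp; omega)]
  · rw [faberSchauder_eq, mul_div_cancel₀ _ (by positivity),
      show ((2 * j + 1 : ℕ) : ℝ) = 2 * ((j + 1 : ℕ) : ℝ) - 1 by push_cast; ring, tent_odd]
    simp
  · intro i _ hi
    rw [faberSchauder_eq, mul_div_cancel₀ _ (by positivity),
      show ((2 * j + 1 : ℕ) : ℝ) = 2 * ((j + 1 : ℕ) : ℝ) - 1 by push_cast; ring, tent_odd]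
    simp [hi]

lemma coefficient_zero_eq {b : unitInterval → ℝ}
    (h : ∀ t, Tendsto (fun N => truncatedSeries x₀ x N t) atTop (𝓝 (b t))) : x₀ = b 1 :=
  tendsto_nhds_unique (by simp [truncatedSeries_one]) (h 1)

/-- The constant `∑ (j + 1) 2 ^ (- j / 2)`. -/
def seriesConst : ℝ := ∑' j : ℕ, ((j : ℝ) + 1) * (√2)⁻¹ ^ j

lemma inv_sqrt_two_lt_one : (√2)⁻¹ < (1 : ℝ) :=
  inv_lt_one_of_one_lt₀ (by rw [Real.lt_sqrt] <;> norm_num)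

lemma summable_seriesConst : Summable fun j : ℕ => ((j : ℝ) + 1) * (√2)⁻¹ ^ j := by
  have hq : ‖(√2 : ℝ)⁻¹‖ < 1 := by
    rw [Real.norm_of_nonneg (by positivity)]; exact inv_sqrt_two_lt_one
  have h1 := summable_pow_mul_geometric_of_norm_lt_one 1 hq
  have h0 := summable_pow_mul_geometric_of_norm_lt_one 0 hq
  exact (h1.add h0).congr fun j => by ring

lemma sum_le_seriesConst (d : ℕ) :
    ∑ j ∈ Finset.range d, ((j : ℝ) + 1) * (√2)⁻¹ ^ j ≤ seriesConst :=
  summable_seriesConst.sum_le_tsum _ fun _ _ => by positivity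

lemma seriesConst_nonneg : 0 ≤ seriesConst := tsum_nonneg fun _ => by positivity

variable {x₀ x} {M : ℝ}

/-- Disjointness of the supports replaces the sum over 2^N indices by a maximum. -/
lemma abs_truncatedSeries_succ_sub_le (hM : 0 ≤ M)
    (hx : ∀ n, ∀ i ∈ Finset.Icc 1 (2 ^ n), |x (n + 1) i| ≤ M * √((n : ℝ) + 1))
    (N : ℕ) (t : unitInterval) :
    |truncatedSeries x₀ x (N + 1) t - truncatedSeries x₀ x N t| ≤
      M * √((N : ℝ) + 1) * (√2)⁻¹ ^ N := by
  rw [truncatedSeries_succ, add_sub_cancel_left]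
  calc _ ≤ ∑ i ∈ Finset.Icc 1 (2 ^ N), |x (N + 1) i * faberSchauder (N + 1) i t| :=
        Finset.abs_sum_le_sum_abs _ _
    _ ≤ ∑ i ∈ Finset.Icc 1 (2 ^ N),
          M * √((N : ℝ) + 1) * (√2)⁻¹ ^ (N + 2) * tent i (2 ^ (N + 1) * (t : ℝ)) := by
        refine Finset.sum_le_sum fun i hi => ?_
        rw [faberSchauder_eq, abs_mul, abs_mul, abs_of_nonneg (tent_nonneg _ _),
          abs_of_nonneg (by positivity : (0 : ℝ) ≤ (√2)⁻¹ ^ (N + 1 + 1)), mul_assoc (M * _)]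
        have := tent_nonneg i (2 ^ (N + 1) * (t : ℝ))
        gcongr
        exact hx N i hi
    _ ≤ M * √((N : ℝ) + 1) * (√2)⁻¹ ^ (N + 2) * 1 := by
        rw [← Finset.mul_sum]
        gcongr
        exact sum_tent_le_one _ _
    _ ≤ _ := by
        rw [mul_one]
        gcongr ?_ * ?_
        exact pow_le_pow_of_le_one (by positivity) inv_sqrt_two_lt_one.le (by omega)

lemma abs_truncatedSeries_sub_le (hM : 0 ≤ M)
    (hx : ∀ n, ∀ i ∈ Finset.Icc 1 (2 ^ n), |x (n + 1) i| ≤ M * √((n : ℝ) + 1))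
    (N d : ℕ) (t : unitInterval) :
    |truncatedSeries x₀ x (N + d) t - truncatedSeries x₀ x N t| ≤
      M * √((N : ℝ) + 1) * (√2)⁻¹ ^ N * seriesConst := by
  have h : |truncatedSeries x₀ x (N + d) t - truncatedSeries x₀ x N t| ≤
      ∑ j ∈ Finset.range d,
        M * √((N : ℝ) + 1) * (√2)⁻¹ ^ N * (((j : ℝ) + 1) * (√2)⁻¹ ^ j) := by
    have htel := Finset.sum_range_sub (fun d => truncatedSeries x₀ x (N + d) t) d
    rw [add_zero] at htel
    rw [← htel]
    refine (Finset.abs_sum_le_sum_abs _ _).trans (Finset.sum_le_sum fun j _ => ?_)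
    refine (abs_truncatedSeries_succ_sub_le hM hx (N + j) t).trans ?_
    -- This crude splitting pulls the dependence on N out of the telescoped sum, leaving a
    -- convergent series in j.
    have hs : √(((N + j : ℕ) : ℝ) + 1) ≤ √((N : ℝ) + 1) * ((j : ℝ) + 1) := by
      rw [Real.sqrt_le_left (by positivity), mul_pow, Real.sq_sqrt (by positivity)]
      push_cast
      nlinarith [mul_nonneg (Nat.cast_nonneg (α := ℝ) N) (Nat.cast_nonneg (α := ℝ) j),
        mul_nonneg (Nat.cast_nonneg (α := ℝ) N) (sq_nonneg (j : ℝ)),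
        (Nat.cast_nonneg (α := ℝ) N), (Nat.cast_nonneg (α := ℝ) j), sq_nonneg (j : ℝ)]
    rw [pow_add]
    calc _ ≤ M * (√((N : ℝ) + 1) * ((j : ℝ) + 1)) * ((√2)⁻¹ ^ N * (√2)⁻¹ ^ j) := by gcongr
      _ = _ := by ring
  refine h.trans ?_
  rw [← Finset.mul_sum]
  gcongr
  exact sum_le_seriesConst d

lemma abs_truncatedSeries_le (hM : 0 ≤ M) (hx₀ : |x₀| ≤ M)
    (hx : ∀ n, ∀ i ∈ Finset.Icc 1 (2 ^ n), |x (n + 1) i| ≤ M * √((n : ℝ) + 1))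
    (N : ℕ) (t : unitInterval) :
    |truncatedSeries x₀ x N t| ≤ (1 + seriesConst) * M := by
  have h := abs_truncatedSeries_sub_le (x₀ := x₀) hM hx 0 N t
  rw [zero_add, truncatedSeries_zero] at h
  simp only [Nat.cast_zero, zero_add, Real.sqrt_one, mul_one, pow_zero] at h
  have h0 : |x₀ * (t : ℝ)| ≤ M := by
    rw [abs_mul, abs_of_nonneg t.2.1]
    exact (mul_le_of_le_one_right (abs_nonneg _) t.2.2).trans hx₀
  have := abs_sub_abs_le_abs_sub (truncatedSeries x₀ x N t) (x₀ * t)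
  linarith

lemma abs_exp_sub_exp_le {a b c : ℝ} (ha : a ≤ c) (hb : b ≤ c) :
    |Real.exp a - Real.exp b| ≤ Real.exp c * |a - b| := by
  wlog h : b ≤ a generalizing a b
  · rw [abs_sub_comm, abs_sub_comm a]
    exact this hb ha (le_of_not_ge h)
  rw [abs_of_nonneg (by linarith [Real.exp_le_exp.2 h]), abs_of_nonneg (by linarith)]
  have h1 : Real.exp a - Real.exp b = Real.exp a * (1 - Real.exp (b - a)) := by
    rw [mul_sub, ← Real.exp_add]; ring_nf
  rw [h1]
  have h2 := Real.add_one_le_exp (b - a)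
  have := Real.exp_le_exp.2 ha
  have := Real.exp_pos a
  calc _ ≤ Real.exp a * (a - b) := mul_le_mul_of_nonneg_left (by linarith) this.le
    _ ≤ _ := mul_le_mul_of_nonneg_right (by assumption) (by linarith)

/-- Pathwise bound of the uniform error in terms of the size of the coefficients. -/
lemma abs_geometric_sub_le (S₀ r σ : ℝ) (hM : 0 ≤ M) (hx₀ : |x₀| ≤ M)
    (hx : ∀ n, ∀ i ∈ Finset.Icc 1 (2 ^ n), |x (n + 1) i| ≤ M * √((n : ℝ) + 1))
    {b : unitInterval → ℝ}
    (h : ∀ t, Tendsto (fun N => truncatedSeries x₀ x N t) atTop (𝓝 (b t)))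
    (N : ℕ) (t : unitInterval) :
    |geometric S₀ r σ b t - geometric S₀ r σ (truncatedSeries x₀ x N) t| ≤
      |S₀| * (Real.exp (|r - σ ^ 2 / 2| + |σ| * ((1 + seriesConst) * M)) *
        (|σ| * (M * √((N : ℝ) + 1) * (√2)⁻¹ ^ N * seriesConst))) := by
  have hN := abs_truncatedSeries_le hM hx₀ hx N t
  have hb : |b t| ≤ (1 + seriesConst) * M :=
    le_of_tendsto (h t).abs (Eventually.of_forall fun N => abs_truncatedSeries_le hM hx₀ hx N t)
  have hd : |b t - truncatedSeries x₀ x N t| ≤ M * √((N : ℝ) + 1) * (√2)⁻¹ ^ N * seriesConst := by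
    refine le_of_tendsto ((h t).sub_const _).abs ?_
    filter_upwards [eventually_ge_atTop N] with m hm
    obtain ⟨d, rfl⟩ := Nat.exists_eq_add_of_le hm
    exact abs_truncatedSeries_sub_le hM hx N d t
  have hc : ∀ y : ℝ, |y| ≤ (1 + seriesConst) * M →
      (r - σ ^ 2 / 2) * (t : ℝ) + σ * y ≤
        |r - σ ^ 2 / 2| + |σ| * ((1 + seriesConst) * M) := by
    intro y hy
    have h1 : (r - σ ^ 2 / 2) * (t : ℝ) ≤ |r - σ ^ 2 / 2| := by
      refine (le_abs_self _).trans ?_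
      rw [abs_mul, abs_of_nonneg t.2.1]
      exact mul_le_of_le_one_right (abs_nonneg _) t.2.2
    have h2 : σ * y ≤ |σ| * ((1 + seriesConst) * M) := by
      refine (le_abs_self _).trans ?_
      rw [abs_mul]
      gcongr
    exact add_le_add h1 h2
  unfold geometric
  rw [← mul_sub, abs_mul]
  gcongr
  refine (abs_exp_sub_exp_le (hc _ hb) (hc _ hN)).trans ?_
  rw [add_sub_add_left_eq_sub, ← mul_sub, abs_mul]
  gcongr

end Deterministic

/-! ### Exponential square moments and control of all coefficients -/

/-- The moment `E exp (Z ^ 2 / 4)` of a standard normal random variable `Z`. -/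
def expSqMoment : ENNReal := ∫⁻ z, ENNReal.ofReal (Real.exp (z ^ 2 / 4)) ∂gaussianReal 0 1

lemma expSqMoment_ne_top : expSqMoment ≠ ⊤ := by
  have hi : Integrable (fun z : ℝ => Real.exp (z ^ 2 / 4)) (gaussianReal 0 1) := by
    rw [gaussianReal_of_var_ne_zero 0 one_ne_zero,
      integrable_withDensity_iff (measurable_gaussianPDF 0 1)
        (Eventually.of_forall fun _ => gaussianPDF_lt_top)]
    -- The Gaussian density leaves exp(-z²/2 + z²/4) = exp(-z²/4).
    have h := (integrable_exp_neg_mul_sq (b := 1 / 4) (by norm_num)).const_mul (√(2 * Real.pi))⁻¹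
    refine h.congr (Eventually.of_forall fun z => ?_)
    simp only [toReal_gaussianPDF, gaussianPDFReal, NNReal.coe_one, mul_one, sub_zero]
    rw [mul_comm (Real.exp _), mul_assoc, ← Real.exp_add]
    congr 2
    ring
  exact ((hasFiniteIntegral_iff_ofReal (Eventually.of_forall fun _ => (Real.exp_pos _).le)).1
    hi.2).ne

/-- A weighted sum of the exponentials `exp (x ^ 2 / 4)` over all coefficients `x`. -/
def expSqSum (x₀ : ℝ) (x : ℕ → ℕ → ℝ) : ENNReal :=
  ENNReal.ofReal (Real.exp (x₀ ^ 2 / 4)) + ∑' n : ℕ, ∑ i ∈ Finset.Icc 1 (2 ^ n),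
    (1 / 4) ^ (n + 1) * ENNReal.ofReal (Real.exp (x (n + 1) i ^ 2 / 4))

/-- The modulus controlling all coefficients. -/
def coefficientBound (w : ℝ) : ℝ := 2 * √(Real.log 4 + Real.log (1 + w))

lemma coefficientBound_nonneg (w : ℝ) : 0 ≤ coefficientBound w := by
  unfold coefficientBound; positivity

lemma sq_coefficientBound {w : ℝ} (hw : 0 ≤ w) :
    coefficientBound w ^ 2 = 4 * (Real.log 4 + Real.log (1 + w)) := by
  have h4 : 0 ≤ Real.log 4 := Real.log_nonneg (by norm_num)
  have hw' : 0 ≤ Real.log (1 + w) := Real.log_nonneg (by linarith)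
  rw [coefficientBound, mul_pow, Real.sq_sqrt (by positivity)]
  norm_num

/-- Taking logarithms gives y²/4 ≤ (n+1) log 4 + log(1+w), which is at most (n+1)(log 4 + log(1+w)).
-/
lemma abs_le_coefficientBound {w y : ℝ} (hw : 0 ≤ w) (n : ℕ)
    (h : (1 / 4) ^ (n + 1) * Real.exp (y ^ 2 / 4) ≤ w) :
    |y| ≤ coefficientBound w * √((n : ℝ) + 1) := by
  refine abs_le_of_sq_le_sq ?_ (mul_nonneg (coefficientBound_nonneg w) (Real.sqrt_nonneg _))
  rw [mul_pow, sq_coefficientBound hw, Real.sq_sqrt (by positivity)]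
  have h1 : Real.exp (y ^ 2 / 4) ≤ 4 ^ (n + 1) * (1 + w) := by
    rw [one_div, inv_pow, inv_mul_le_iff₀ (by positivity)] at h
    refine h.trans ?_
    gcongr
    linarith
  have h2 := Real.log_le_log (Real.exp_pos _) h1
  rw [Real.log_exp, Real.log_mul (by positivity) (by positivity), Real.log_pow] at h2
  have hw' : 0 ≤ Real.log (1 + w) := Real.log_nonneg (by linarith)
  push_cast at h2
  nlinarith [mul_nonneg (Nat.cast_nonneg (α := ℝ) n) hw']

lemma abs_coefficient_le {x₀ : ℝ} {x : ℕ → ℕ → ℝ} (h : expSqSum x₀ x ≠ ⊤) (n : ℕ) {i : ℕ}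
    (hi : i ∈ Finset.Icc 1 (2 ^ n)) :
    |x (n + 1) i| ≤ coefficientBound (expSqSum x₀ x).toReal * √((n : ℝ) + 1) := by
  refine abs_le_coefficientBound ENNReal.toReal_nonneg n ?_
  have h1 : (1 / 4) ^ (n + 1) * ENNReal.ofReal (Real.exp (x (n + 1) i ^ 2 / 4)) ≤
      expSqSum x₀ x :=
    ((Finset.single_le_sum (f := fun i => (1 / 4 : ENNReal) ^ (n + 1) *
        ENNReal.ofReal (Real.exp (x (n + 1) i ^ 2 / 4))) (fun _ _ => zero_le) hi).trans
      (ENNReal.le_tsum (f := fun n : ℕ => ∑ i ∈ Finset.Icc 1 (2 ^ n), (1 / 4 : ENNReal) ^ (n + 1) *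
        ENNReal.ofReal (Real.exp (x (n + 1) i ^ 2 / 4))) n)).trans le_add_self
  have h2 := ENNReal.toReal_mono h h1
  rw [ENNReal.toReal_mul, ENNReal.toReal_ofReal (Real.exp_pos _).le] at h2
  simpa using h2

lemma abs_coefficient_zero_le {x₀ : ℝ} {x : ℕ → ℕ → ℝ} (h : expSqSum x₀ x ≠ ⊤) :
    |x₀| ≤ coefficientBound (expSqSum x₀ x).toReal := by
  have h2 : Real.exp (x₀ ^ 2 / 4) ≤ (expSqSum x₀ x).toReal := by
    have := ENNReal.toReal_mono h (le_self_add : ENNReal.ofReal (Real.exp (x₀ ^ 2 / 4)) ≤ _)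
    rwa [ENNReal.toReal_ofReal (Real.exp_pos _).le] at this
  have := abs_le_coefficientBound (y := x₀) ENNReal.toReal_nonneg 0 (w := (expSqSum x₀ x).toReal) (by
    have := Real.exp_pos (x₀ ^ 2 / 4)
    norm_num at *
    linarith)
  simpa using this

/-- With M the coefficient bound, aM ≤ a² + M²/4, and M²/4 is exactly log(4(1+w)). Linear growth in
w is essential, since only a first moment of W is available. -/
lemma exp_mul_coefficientBound_le (a : ℝ) {w : ℝ} (hw : 0 ≤ w) :
    Real.exp (a * coefficientBound w) ≤ 4 * Real.exp (a ^ 2) * (1 + w) := by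
  have h : a * coefficientBound w ≤ a ^ 2 + Real.log 4 + Real.log (1 + w) := by
    nlinarith [sq_coefficientBound hw, sq_nonneg (a - coefficientBound w / 2)]
  refine (Real.exp_le_exp.2 h).trans_eq ?_
  rw [Real.exp_add, Real.exp_add, Real.exp_log (by norm_num), Real.exp_log (by positivity)]
  ring

/-- A constant depending only on `r` and `σ` in the pathwise bound of the error. -/
def pathConst (r σ : ℝ) : ℝ :=
  8 * Real.exp (|r - σ ^ 2 / 2|) * Real.exp ((|σ| * (1 + seriesConst) + 1) ^ 2) * |σ| * seriesConst

lemma pathConst_nonneg (r σ : ℝ) : 0 ≤ pathConst r σ := by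
  have := seriesConst_nonneg
  unfold pathConst
  positivity

lemma inv_sqrt_two_pow (N : ℕ) : (√2 : ℝ)⁻¹ ^ N = ((2 : ℝ) ^ ((N : ℝ) / 2))⁻¹ := by
  rw [inv_pow, show (N : ℝ) / 2 = 1 / 2 * (N : ℝ) by ring, Real.rpow_mul (by norm_num),
    ← Real.sqrt_eq_rpow, Real.rpow_natCast]

lemma abs_geometric_sub_le_expSqSum (S₀ r σ : ℝ) {x₀ : ℝ} {x : ℕ → ℕ → ℝ}
    (hw : expSqSum x₀ x ≠ ⊤) {b : unitInterval → ℝ}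
    (h : ∀ t, Tendsto (fun N => truncatedSeries x₀ x N t) atTop (𝓝 (b t)))
    {N : ℕ} (hN : 1 ≤ N) (t : unitInterval) :
    |geometric S₀ r σ b t - geometric S₀ r σ (truncatedSeries x₀ x N) t| ≤
      pathConst r σ * |S₀| * (√N / (2 : ℝ) ^ ((N : ℝ) / 2)) * (1 + (expSqSum x₀ x).toReal) := by
  refine (abs_geometric_sub_le S₀ r σ (coefficientBound_nonneg _) (abs_coefficient_zero_le hw)
    (fun n i hi => abs_coefficient_le hw n hi) h N t).trans ?_
  have hw0 : 0 ≤ (expSqSum x₀ x).toReal := ENNReal.toReal_nonneg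
  generalize (expSqSum x₀ x).toReal = w at *
  have hM := coefficientBound_nonneg w
  have hK := seriesConst_nonneg
  -- Here N ≥ 1 is needed: the right side vanishes at N = 0.
  have hs : √((N : ℝ) + 1) ≤ 2 * √N := by
    have : (1 : ℝ) ≤ N := by exact_mod_cast hN
    rw [Real.sqrt_le_left (by positivity), mul_pow, Real.sq_sqrt (by positivity)]
    linarith
  -- The extra factor M is absorbed by M ≤ exp M, whence the + 1 in the exponent of `pathConst`.
  have he : Real.exp (|r - σ ^ 2 / 2| + |σ| * ((1 + seriesConst) * coefficientBound w)) *
      coefficientBound w ≤ Real.exp (|r - σ ^ 2 / 2|) *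
        (4 * Real.exp ((|σ| * (1 + seriesConst) + 1) ^ 2) * (1 + w)) := by
    refine le_trans ?_ (mul_le_mul_of_nonneg_left (exp_mul_coefficientBound_le _ hw0)
      (Real.exp_pos _).le)
    rw [add_mul _ 1, one_mul, Real.exp_add, Real.exp_add, mul_assoc, mul_assoc |σ|]
    gcongr
    linarith [Real.add_one_le_exp (coefficientBound w)]
  rw [inv_sqrt_two_pow]
  calc _ = |S₀| * |σ| * seriesConst * √((N : ℝ) + 1) * ((2 : ℝ) ^ ((N : ℝ) / 2))⁻¹ *
        (Real.exp (|r - σ ^ 2 / 2| + |σ| * ((1 + seriesConst) * coefficientBound w)) *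
      coefficientBound w) := by ring
    _ ≤ |S₀| * |σ| * seriesConst * (2 * √N) * ((2 : ℝ) ^ ((N : ℝ) / 2))⁻¹ *
        (Real.exp (|r - σ ^ 2 / 2|) *
        (4 * Real.exp ((|σ| * (1 + seriesConst) + 1) ^ 2) * (1 + w))) := by gcongr
    _ = _ := by unfold pathConst; ring

variable {Ω : Type*} [MeasurableSpace Ω] {P : Measure Ω}

lemma lintegral_exp_sq {Z : Ω → ℝ} (hZ : HasLaw Z (gaussianReal 0 1) P) :
    ∫⁻ ω, ENNReal.ofReal (Real.exp (Z ω ^ 2 / 4)) ∂P = expSqMoment := by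
  rw [expSqMoment, ← hZ.map_eq, lintegral_map' (by fun_prop) hZ.aemeasurable]

lemma aemeasurable_expSqSum {X₀ : Ω → ℝ} {X : ℕ → ℕ → Ω → ℝ}
    (h₀ : AEMeasurable X₀ P)
    (h : ∀ n, ∀ i ∈ Finset.Icc 1 (2 ^ n), AEMeasurable (X (n + 1) i) P) :
    AEMeasurable (fun ω => expSqSum (X₀ ω) fun n i => X n i ω) P := by
  have hm : ∀ n : ℕ, AEMeasurable (fun ω => ∑ i ∈ Finset.Icc 1 (2 ^ n), (1 / 4 : ENNReal) ^ (n + 1) *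
      ENNReal.ofReal (Real.exp (X (n + 1) i ω ^ 2 / 4))) P := fun n =>
    Finset.aemeasurable_fun_sum _ fun i hi => by
      have := h n i hi
      fun_prop
  have h₀' : AEMeasurable (fun ω => ENNReal.ofReal (Real.exp (X₀ ω ^ 2 / 4))) P := by fun_prop
  exact h₀'.add (AEMeasurable.tsum hm)

/-- Level n + 1 has 2^n terms of weight 4^(-n-1), together at most 2^(-n); summing gives 2, and X₀
adds 1. -/
lemma lintegral_expSqSum_le {X₀ : Ω → ℝ} {X : ℕ → ℕ → Ω → ℝ}
    (h₀ : HasLaw X₀ (gaussianReal 0 1) P)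
    (h : ∀ n, ∀ i ∈ Finset.Icc 1 (2 ^ n), HasLaw (X (n + 1) i) (gaussianReal 0 1) P) :
    ∫⁻ ω, expSqSum (X₀ ω) (fun n i => X n i ω) ∂P ≤ 3 * expSqMoment := by
  have hm₀ := h₀.aemeasurable
  have hm : ∀ n, ∀ i ∈ Finset.Icc 1 (2 ^ n), AEMeasurable (fun ω =>
      (1 / 4 : ENNReal) ^ (n + 1) * ENNReal.ofReal (Real.exp (X (n + 1) i ω ^ 2 / 4))) P := by
    intro n i hi
    have := (h n i hi).aemeasurable
    fun_prop
  unfold expSqSum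
  rw [lintegral_add_left' (by fun_prop), lintegral_exp_sq h₀,
    lintegral_tsum fun n => Finset.aemeasurable_fun_sum _ (hm n)]
  have hn : ∀ n : ℕ, ∫⁻ ω, ∑ i ∈ Finset.Icc 1 (2 ^ n), (1 / 4 : ENNReal) ^ (n + 1) *
      ENNReal.ofReal (Real.exp (X (n + 1) i ω ^ 2 / 4)) ∂P ≤ 2⁻¹ ^ n * expSqMoment := by
    intro n
    rw [lintegral_finsetSum' _ (hm n)]
    have : ∀ i ∈ Finset.Icc 1 (2 ^ n), ∫⁻ ω, (1 / 4 : ENNReal) ^ (n + 1) *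
        ENNReal.ofReal (Real.exp (X (n + 1) i ω ^ 2 / 4)) ∂P =
          (1 / 4 : ENNReal) ^ (n + 1) * expSqMoment := by
      intro i hi
      have hX := (h n i hi).aemeasurable
      rw [lintegral_const_mul'' _ (by fun_prop), lintegral_exp_sq (h n i hi)]
    rw [Finset.sum_congr rfl this, Finset.sum_const, Nat.card_Icc, Nat.add_sub_cancel,
      nsmul_eq_mul, ← mul_assoc]
    gcongr
    have h4 : (1 / 4 : ENNReal) = 2⁻¹ * 2⁻¹ := by
      rw [one_div, ← ENNReal.mul_inv (by simp) (by simp)]; norm_num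
    calc ((2 ^ n : ℕ) : ENNReal) * (1 / 4) ^ (n + 1) ≤ ((2 ^ n : ℕ) : ENNReal) * (1 / 4) ^ n := by
          refine mul_le_mul_right (pow_le_pow_right_of_le_one' ?_ (Nat.le_succ n)) _
          rw [one_div]
          exact ENNReal.inv_le_one.2 (by norm_num)
      _ = 2⁻¹ ^ n := by
          rw [h4, Nat.cast_pow, Nat.cast_ofNat, ← mul_pow, ← mul_assoc,
            ENNReal.mul_inv_cancel (by simp) (by simp), one_mul]
  calc _ ≤ expSqMoment + ∑' n : ℕ, 2⁻¹ ^ n * expSqMoment := by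
        gcongr with n
        exact hn n
    _ = 3 * expSqMoment := by
        rw [ENNReal.tsum_mul_right, ENNReal.tsum_geometric, ENNReal.one_sub_inv_two, inv_inv]
        ring

/-! ### Laws of the coefficients -/

section Laws

variable {B : unitInterval → Ω → ℝ}

lemma IsStandardBrownianMotion.memLp (hB : IsStandardBrownianMotion B P) (t : unitInterval) :
    MemLp (B t) 2 P := (hB.gaussian.hasGaussianLaw_eval t).memLp_two

lemma hasLaw_gaussianReal_of_moments {Z : Ω → ℝ} (hZ : HasGaussianLaw Z P)
    (h1 : ∫ ω, Z ω ∂P = 0) (h2 : ∫ ω, Z ω ^ 2 ∂P = 1) : HasLaw Z (gaussianReal 0 1) P where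
  aemeasurable := hZ.aemeasurable
  map_eq := by
    rw [hZ.map_eq_gaussianReal, variance_of_integral_eq_zero hZ.aemeasurable h1, h1, h2]
    simp

lemma IsStandardBrownianMotion.hasLaw_one (hB : IsStandardBrownianMotion B P) :
    HasLaw (B 1) (gaussianReal 0 1) P :=
  hasLaw_gaussianReal_of_moments (hB.gaussian.hasGaussianLaw_eval 1) (hB.mean_zero 1) (by
    simpa [sq] using hB.covariance 1 1)

/-- The second difference of a Brownian motion around a midpoint, normalized. -/
lemma IsStandardBrownianMotion.hasLaw_secondDifference (hB : IsStandardBrownianMotion B P)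
    {l m r : unitInterval} (hm : (m : ℝ) = ((l : ℝ) + r) / 2) (hlr : (l : ℝ) < r) {c : ℝ}
    (hc : c ^ 2 * (((r : ℝ) - l) / 4) = 1) :
    HasLaw (fun ω => c * (B m ω - (B l ω + B r ω) / 2)) (gaussianReal 0 1) P := by
  have hi := fun t => (hB.gaussian.hasGaussianLaw_eval t).integrable
  have hii : ∀ s t, Integrable (fun ω => B s ω * B t ω) P :=
    fun s t => (hB.memLp s).integrable_mul (hB.memLp t)
  refine hasLaw_gaussianReal_of_moments ?_ ?_ ?_
  · classical
    have hp : IsGaussianProcess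
        (fun (_ : Unit) ω => c * (B m ω - (B l ω + B r ω) / 2)) P :=
      hB.gaussian.of_isGaussianProcess fun _ => ⟨{l, m, r},
        c • (ContinuousLinearMap.proj ⟨m, by simp⟩ - (2 : ℝ)⁻¹ •
          (ContinuousLinearMap.proj ⟨l, by simp⟩ + ContinuousLinearMap.proj ⟨r, by simp⟩)),
        fun ω => by simp; left; ring⟩
    exact hp.hasGaussianLaw_eval ()
  · have hlr' : Integrable (fun ω => (B l ω + B r ω) / 2) P := ((hi l).add (hi r)).div_const 2
    rw [integral_const_mul, integral_sub (hi m) hlr', integral_div, integral_add (hi l) (hi r)]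
    simp [hB.mean_zero]
  · have e : ∀ ω, (c * (B m ω - (B l ω + B r ω) / 2)) ^ 2 =
        c ^ 2 * (B m ω * B m ω + 4⁻¹ * (B l ω * B l ω) + 4⁻¹ * (B r ω * B r ω) -
          (B m ω * B l ω) - (B m ω * B r ω) + 2⁻¹ * (B l ω * B r ω)) := fun ω => by ring
    simp_rw [e]
    rw [integral_const_mul, integral_add, integral_sub, integral_sub, integral_add, integral_add]
    · simp only [integral_const_mul, hB.covariance, min_self]
      -- The covariances combine to m + l/4 + r/4 - l - m + l/2 = (r - l)/4.
      rw [min_eq_right (by linarith), min_eq_left (by linarith), min_eq_left (by linarith), hm,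
        ← hc]
      ring
    all_goals
      have h1 := hii m m
      have h2 := hii l l
      have h3 := hii r r
      have h4 := hii m l
      have h5 := hii m r
      have h6 := hii l r
      fun_prop

variable {X₀ : Ω → ℝ} {X : ℕ → ℕ → Ω → ℝ}

/-- The constant coefficient of the expansion of a Brownian motion is standard normal. -/
lemma IsLevyCiesielskiExpansion.hasLaw_zero (h : IsLevyCiesielskiExpansion X₀ X B P)
    (hB : IsStandardBrownianMotion B P) : HasLaw X₀ (gaussianReal 0 1) P := by
  refine hB.hasLaw_one.congr ?_
  filter_upwards [h] with ω hω
  exact coefficient_zero_eq _ _ hω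

/-- The coefficients of the expansion of a Brownian motion are standard normal. -/
lemma IsLevyCiesielskiExpansion.hasLaw (h : IsLevyCiesielskiExpansion X₀ X B P)
    (hB : IsStandardBrownianMotion B P) {n i : ℕ} (hi : i ∈ Finset.Icc 1 (2 ^ n)) :
    HasLaw (X (n + 1) i) (gaussianReal 0 1) P := by
  obtain ⟨hi1, hi2⟩ := Finset.mem_Icc.1 hi
  obtain ⟨j, rfl⟩ := Nat.exists_eq_add_of_le' hi1
  have hk : 2 * j + 1 ≤ 2 ^ (n + 1) := by rw [pow_succ]; omega
  have hs : (√2 : ℝ) ^ 2 = 2 := Real.sq_sqrt (by norm_num)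
  have hl : HasLaw (fun ω => √2 ^ (n + 2) * (B (dyadic (n + 1) (2 * j + 1)) ω -
      (B (dyadic n j) ω + B (dyadic n (j + 1)) ω) / 2)) (gaussianReal 0 1) P := by
    -- The interval has length 2^(-n), so the variance is 2^(-n-2), the inverse square of √2^(n+2).
    apply hB.hasLaw_secondDifference <;>
      simp only [coe_dyadic hk, coe_dyadic hi2, coe_dyadic (show j ≤ 2 ^ n by omega)]
    · push_cast; rw [pow_succ]; field_simp; ring
    · gcongr; omega
    · rw [← pow_mul, mul_comm (n + 2), pow_mul, hs, pow_add]; push_cast; field_simp; ring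
  refine hl.congr ?_
  filter_upwards [h] with ω hω
  rw [← coefficient_eq _ _ hω hi2, inv_pow]
  field_simp

end Laws

/-! ### Measurability of the uniform error -/

/-- Continuity reduces the uncountable supremum to a countable one, which preserves a.e.
measurability. -/
lemma ciSup_abs_eq_ciSup_denseSeq {f : unitInterval → ℝ} (hf : Continuous f) :
    ⨆ t, |f t| = ⨆ k, |f (TopologicalSpace.denseSeq unitInterval k)| := by
  have hb : BddAbove (Set.range fun t => |f t|) :=
    (isCompact_range hf.abs).bddAbove
  have hb' : BddAbove (Set.range fun k => |f (TopologicalSpace.denseSeq unitInterval k)|) :=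
    hb.mono (Set.range_comp_subset_range _ fun t => |f t|)
  refine le_antisymm (ciSup_le fun t => ?_) (ciSup_le fun k => le_ciSup hb _)
  refine (TopologicalSpace.denseRange_denseSeq unitInterval).induction_on t
    (isClosed_le hf.abs continuous_const) fun k => ?_
  exact le_ciSup hb' k

lemma continuous_geometric (S₀ r σ : ℝ) {b : unitInterval → ℝ} (hb : Continuous b) :
    Continuous (geometric S₀ r σ b) := by
  unfold geometric
  fun_prop

lemma aemeasurable_uniformError (S₀ r σ : ℝ) {B : unitInterval → Ω → ℝ} {X₀ : Ω → ℝ}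
    {X : ℕ → ℕ → Ω → ℝ} (hB : IsStandardBrownianMotion B P)
    (h : IsLevyCiesielskiExpansion X₀ X B P) (N : ℕ) :
    AEMeasurable (uniformError S₀ r σ B X₀ X N) P := by
  have hm : AEMeasurable (fun ω => ⨆ k,
      |geometric S₀ r σ (fun s => B s ω) (TopologicalSpace.denseSeq unitInterval k) -
        geometric S₀ r σ (truncatedSeries (X₀ ω) (fun n i => X n i ω) N)
          (TopologicalSpace.denseSeq unitInterval k)|) P := by
    refine AEMeasurable.iSup fun k => ?_
    have hX₀ := (h.hasLaw_zero hB).aemeasurable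
    have hBk := hB.gaussian.aemeasurable (TopologicalSpace.denseSeq unitInterval k)
    have ht : AEMeasurable (fun ω => truncatedSeries (X₀ ω) (fun n i => X n i ω) N
        (TopologicalSpace.denseSeq unitInterval k)) P := by
      unfold truncatedSeries
      refine AEMeasurable.add (by fun_prop) (Finset.aemeasurable_fun_sum _ fun n hn =>
        Finset.aemeasurable_fun_sum _ fun i hi => ?_)
      obtain ⟨n, rfl⟩ := Nat.exists_eq_add_of_le' (Finset.mem_Icc.1 hn).1
      exact (h.hasLaw hB hi).aemeasurable.mul_const _
    unfold geometric
    fun_prop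
  refine hm.congr ?_
  filter_upwards [hB.continuous_paths] with ω hω
  exact (ciSup_abs_eq_ciSup_denseSeq ((continuous_geometric S₀ r σ hω).sub
    (continuous_geometric S₀ r σ (continuous_truncatedSeries _ _ N)))).symm

/-! ### The expected error -/

/-- A constant depending only on `r` and `σ` in the bound of the expected error. -/
def meanConst (r σ : ℝ) : ℝ := pathConst r σ * (1 + (3 * expSqMoment).toReal) + 1

lemma meanConst_pos (r σ : ℝ) : 0 < meanConst r σ := by
  have := pathConst_nonneg r σ
  -- The summand 1 keeps the constant positive when σ = 0, where `pathConst` vanishes.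
  unfold meanConst
  positivity

lemma integrable_uniformError_and_integral_le [IsProbabilityMeasure P] (S₀ r σ : ℝ)
    {B : unitInterval → Ω → ℝ} {X₀ : Ω → ℝ} {X : ℕ → ℕ → Ω → ℝ}
    (hB : IsStandardBrownianMotion B P) (h : IsLevyCiesielskiExpansion X₀ X B P)
    {N : ℕ} (hN : 1 ≤ N) :
    Integrable (uniformError S₀ r σ B X₀ X N) P ∧
      ∫ ω, uniformError S₀ r σ B X₀ X N ω ∂P ≤
        meanConst r σ * |S₀| * (√N / (2 : ℝ) ^ ((N : ℝ) / 2)) := by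
  set W : Ω → ENNReal := fun ω => expSqSum (X₀ ω) fun n i => X n i ω with hW
  have hWm : AEMeasurable W P := aemeasurable_expSqSum (h.hasLaw_zero hB).aemeasurable
    fun n i hi => (h.hasLaw hB hi).aemeasurable
  have hWle : ∫⁻ ω, W ω ∂P ≤ 3 * expSqMoment :=
    lintegral_expSqSum_le (h.hasLaw_zero hB) fun n i hi => h.hasLaw hB hi
  have hfin : 3 * expSqMoment ≠ ⊤ := ENNReal.mul_ne_top (by norm_num) expSqMoment_ne_top
  have hWtop : ∫⁻ ω, W ω ∂P ≠ ⊤ := ne_top_of_le_ne_top hfin hWle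
  have hWae := ae_lt_top' hWm hWtop
  have hWint : Integrable (fun ω => (W ω).toReal) P := integrable_toReal_of_lintegral_ne_top hWm hWtop
  set A : ℝ := |S₀| * (√N / (2 : ℝ) ^ ((N : ℝ) / 2)) with hA
  have hA0 : 0 ≤ A := by positivity
  have hle : ∀ᵐ ω ∂P, uniformError S₀ r σ B X₀ X N ω ≤
      pathConst r σ * A * (1 + (W ω).toReal) := by
    filter_upwards [hWae, h] with ω hω hω'
    refine ciSup_le fun t => ?_
    rw [hA, ← mul_assoc (pathConst r σ)]
    exact abs_geometric_sub_le_expSqSum S₀ r σ hω.ne hω' hN t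
  have hint : Integrable (fun ω => pathConst r σ * A * (1 + (W ω).toReal)) P :=
    ((integrable_const 1).add hWint).const_mul _
  have herr : Integrable (uniformError S₀ r σ B X₀ X N) P := by
    refine hint.mono' (aemeasurable_uniformError S₀ r σ hB h N).aestronglyMeasurable ?_
    filter_upwards [hle] with ω hω
    have h0 : 0 ≤ uniformError S₀ r σ B X₀ X N ω := Real.iSup_nonneg fun t => abs_nonneg _
    rwa [Real.norm_of_nonneg h0]
  refine ⟨herr, (integral_mono_ae herr hint hle).trans ?_⟩
  rw [integral_const_mul, integral_add (integrable_const 1) hWint, integral_toReal hWm hWae]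
  have hi : (∫⁻ ω, W ω ∂P).toReal ≤ (3 * expSqMoment).toReal := ENNReal.toReal_mono hfin hWle
  have hp := pathConst_nonneg r σ
  calc _ ≤ pathConst r σ * A * (1 + (3 * expSqMoment).toReal) := by
        simp only [integral_const, probReal_univ, smul_eq_mul, one_mul]
        gcongr
    _ ≤ meanConst r σ * A := by unfold meanConst; nlinarith
    _ = _ := by rw [hA, mul_assoc]

/-- Since log(2^N) = N log 2, the two rates differ only by the factor √(log 2). -/
lemma sqrt_div_two_rpow_eq (N : ℕ) : √N / (2 : ℝ) ^ ((N : ℝ) / 2) =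
    (√(Real.log 2))⁻¹ * √(Real.log ((2 : ℝ) ^ N) / (2 : ℝ) ^ N) := by
  have hl : 0 < Real.log 2 := Real.log_pos (by norm_num)
  rw [Real.log_pow, Real.sqrt_div (by positivity), Real.sqrt_mul (by positivity), div_eq_mul_inv,
    ← inv_sqrt_two_pow, inv_pow]
  have : √((2 : ℝ) ^ N) = √2 ^ N := by
    rw [Real.sqrt_eq_iff_mul_self_eq (by positivity) (by positivity), ← mul_pow,
      Real.mul_self_sqrt (by norm_num)]
  rw [this]
  field_simp

end GBM
end

theorem theorem1 (r σ : ℝ) :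
    ∃ C : ℝ, 0 < C ∧
      ∀ (Ω : Type*) [MeasurableSpace Ω] (P : Measure Ω) [IsProbabilityMeasure P]
        (B : unitInterval → Ω → ℝ) (X₀ : Ω → ℝ) (X : ℕ → ℕ → Ω → ℝ),
        GBM.IsStandardBrownianMotion B P →
        GBM.IsLevyCiesielskiExpansion X₀ X B P →
        ∀ (S₀ : ℝ) (N : ℕ), 1 ≤ N →
          Integrable (GBM.uniformError S₀ r σ B X₀ X N) P ∧
          ∫ ω, GBM.uniformError S₀ r σ B X₀ X N ω ∂P
            ≤ C * |S₀| * (Real.sqrt N / (2 : ℝ) ^ ((N : ℝ) / 2)) ∧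
          ∫ ω, GBM.uniformError S₀ r σ B X₀ X N ω ∂P
            ≤ C * |S₀| * Real.sqrt (Real.log ((2 : ℝ) ^ N) / (2 : ℝ) ^ N) := by
  have hC := GBM.meanConst_pos r σ
  have hl : (0 : ℝ) ≤ (√(Real.log 2))⁻¹ := by positivity
  -- Adding 1 and 1/√(log 2) makes one constant serve both bounds.
  refine ⟨GBM.meanConst r σ * (1 + (√(Real.log 2))⁻¹), by positivity, ?_⟩
  intro Ω _ P _ B X₀ X hB h S₀ N hN
  obtain ⟨hi, hle⟩ := GBM.integrable_uniformError_and_integral_le S₀ r σ hB h hN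
  refine ⟨hi, hle.trans ?_, hle.trans ?_⟩
  · gcongr
    exact le_mul_of_one_le_right hC.le (by linarith)
  · rw [GBM.sqrt_div_two_rpow_eq]
    calc _ = GBM.meanConst r σ * (√(Real.log 2))⁻¹ * |S₀| *
          √(Real.log ((2 : ℝ) ^ N) / (2 : ℝ) ^ N) := by ring
      _ ≤ _ := by
          gcongr
          linarith
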